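/- All graphs are finite and simple. For graphs $H,G$ with $V(G)\neq\emptyset$ let $t(H,G)$ be the probability that a uniform random map $V(H)\to V(G)$ is a graph homomorphism, and let $e$ be the graph consisting of a single edge. **Reflection complexes.** A $b$-hypergraph $M=(V,E,B)$ is a set $V$ with a set $E\subseteq 2^V$ of edges and a symmetric relation $B\subseteq 2^V\times 2^V$. For $L\subseteq V$, the sub-$b$-hypergraph on $L$ has vertex set $L$, the edges of $M$ contained in $L$, and the relation $B\cap(2^L\times 2^L)$. Given an edge $L\in E$ and any $X\subseteq L$, let $N$ be the sub-$b$-hypergraph on $L$, and glue a copy of $N$ to $M$ along $X$: let $\tau_1:V\to V'$ and $\tau_2:L\to V'$ be injective maps with $V'=\tau_1(V)\cup\tau_2(L)$ and with $\tau_1(v)=\tau_2(w)$ if and only if $v=w\in X$. Then $r_{L,X}(M)$ is the $b$-hypergraph on $V'$ whose edges are the $\tau_1$-images of edges of $M$, the $\tau_2$-images of edges of $N$, and all sets $\tau_1(K_1)\cup\tau_2(K_2)$ where $K_1$ is an edge of $M$, $K_2$ is an edge of $N$ and $X\subseteq K_1\cap K_2$; its relation consists of the $\tau_1$-images of the pairs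 in $B$, the $\tau_2$-images of the pairs in the relation of $N$, and the pairs $(\tau_1(K_1),\tau_2(K_2))$ and $(\tau_2(K_2),\tau_1(K_1))$ for all $K_1,K_2$ as above. A reflection complex is a $b$-hypergraph obtained by finitely many (possibly zero) such operations from a $b$-hypergraph with two vertices, whose only edge is the whole vertex set and whose relation is empty. The frame of $M$ is the graph on $V$ whose edges are the two-element edges of $M$. **Thick graphs.** For $S\subseteq V$ let $1_S\in\mathbb{R}^{2^V}$ be the function on subsets of $V$ that is $1$ at $S$ and $0$ elsewhere, and for $A,B\subseteq V$ let $t_{A,B}=1_{A\cup B}-1_A-1_B+1_{A\cap B}$. Let $W_B$ be the real linear span of the functions $t_{A_1,A_2}$ with $(A_1,A_2)\in B$. Let $Q_V$ be the sum of the line $\mathbb{R}1_\emptyset$ and the cone of all non-negative linear combinations of the functions $t_{A_1,A_2}$ and $1_{A_1}$ with $A_1,A_2\subseteq V$. For a graph $H$ on $V$ let $$h_H(V)=-1_V+\sum_{f\in E(H)}1_f-\sum_{v\in V}(\deg_H(v)-1)\,1_{\{v\}}.$$ A graph $H$ is thick if it is the frame of a reflection complex $M=(V,E,B)$ with $h_H(V)\in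 W_B+Q_V$. **Theorem.** Every thick graph $H$ satisfies Sidorenko's conjecture: for every finite graph $G$ with at least one vertex, $$t(H,G)\ \ge\ t(e,G)^{|E(H)|}.$$ -/

import Mathlib

open scoped Pointwise

noncomputable section

universe u

/-- A hypergraph on the vertex set `V`, together with a symmetric binary relation on the subsets
of `V`. -/
structure BHypergraph (V : Type u) where
  edges : Set (Set V)
  rel : Set V → Set V → Prop
  rel_symm : ∀ A B, rel A B → rel B A

namespace BHypergraph

/-- The trivial b-hypergraph: the only edge is the whole vertex set, and the relation is empty.
It is used only on two-point vertex sets. -/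
def triv (V : Type u) : BHypergraph V where
  edges := {Set.univ}
  rel _ _ := False
  rel_symm _ _ h := h

/-- The sub-b-hypergraph on a subset `W` of the vertex set: its edges are the edges contained in
`W`, and its relation is the restriction of the relation to subsets of `W`. -/
def sub {V : Type u} (M : BHypergraph V) (W : Set V) : BHypergraph W where
  edges := {K | Subtype.val '' K ∈ M.edges}
  rel A B := M.rel (Subtype.val '' A) (Subtype.val '' B)
  rel_symm _ _ h := M.rel_symm _ _ h

/-- `V`, with the maps `τ₁`, `τ₂`, is obtained from the disjoint union of `V₁` and `V₂` by
identifying `φ₁ f` with `φ₂ f` for every label `f : F`. -/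
structure IsGluing {F V₁ V₂ V : Type u} (φ₁ : F → V₁) (φ₂ : F → V₂) (τ₁ : V₁ → V) (τ₂ : V₂ → V) :
    Prop where
  inj₁ : Function.Injective τ₁
  inj₂ : Function.Injective τ₂
  eq_iff : ∀ v₁ v₂, τ₁ v₁ = τ₂ v₂ ↔ ∃ f, φ₁ f = v₁ ∧ φ₂ f = v₂
  cover : Set.range τ₁ ∪ Set.range τ₂ = Set.univ

/-- The b-hypergraph `M₁ ∪* M₂` on a gluing of the vertex sets. Edges and relations of the first
type are the copies of those of `M₁` and `M₂`. For all edges `K₁` of `M₁` and `K₂` of `M₂` that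
contain all labelled vertices there is an edge of the second type, the union of the copies of `K₁`
and `K₂`, and a relation of the second type (in both orders) between these two copies. -/
def starGlue {F V₁ V₂ V : Type u} (M₁ : BHypergraph V₁) (M₂ : BHypergraph V₂)
    (φ₁ : F → V₁) (φ₂ : F → V₂) (τ₁ : V₁ → V) (τ₂ : V₂ → V) : BHypergraph V where
  edges := {K | (∃ K₁ ∈ M₁.edges, K = τ₁ '' K₁) ∨ (∃ K₂ ∈ M₂.edges, K = τ₂ '' K₂) ∨
    ∃ K₁ ∈ M₁.edges, ∃ K₂ ∈ M₂.edges, Set.range φ₁ ⊆ K₁ ∧ Set.range φ₂ ⊆ K₂ ∧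
      K = τ₁ '' K₁ ∪ τ₂ '' K₂}
  rel A B :=
    (∃ A₁ B₁, M₁.rel A₁ B₁ ∧ A = τ₁ '' A₁ ∧ B = τ₁ '' B₁) ∨
    (∃ A₂ B₂, M₂.rel A₂ B₂ ∧ A = τ₂ '' A₂ ∧ B = τ₂ '' B₂) ∨
    ∃ K₁ ∈ M₁.edges, ∃ K₂ ∈ M₂.edges, Set.range φ₁ ⊆ K₁ ∧ Set.range φ₂ ⊆ K₂ ∧
      ((A = τ₁ '' K₁ ∧ B = τ₂ '' K₂) ∨ (A = τ₂ '' K₂ ∧ B = τ₁ '' K₁))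
  rel_symm := by
    rintro A B (⟨A₁, B₁, h, hA, hB⟩ | ⟨A₂, B₂, h, hA, hB⟩ | ⟨K₁, h₁, K₂, h₂, s₁, s₂, h⟩)
    · exact Or.inl ⟨B₁, A₁, M₁.rel_symm _ _ h, hB, hA⟩
    · exact Or.inr (Or.inl ⟨B₂, A₂, M₂.rel_symm _ _ h, hB, hA⟩)
    · exact Or.inr (Or.inr ⟨K₁, h₁, K₂, h₂, s₁, s₂, h.symm.imp And.symm And.symm⟩)

/-- Reflection complexes: the b-hypergraphs obtained from the trivial one on two vertices by
finitely many operations `M ↦ r_{L,X}(M)`, where `L` is an edge of `M`, `X ⊆ L`, and `r_{L,X}(M)` is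
`M ∪* N` for the sub-b-hypergraph `N` of `M` on `L`, glued along the inclusions of `X`.
The vertex set of a gluing is determined only up to bijection, so the predicate is
invariant under isomorphism. -/
inductive IsReflectionComplex : ∀ {V : Type u}, BHypergraph V → Prop
  | triv {V : Type u} (hV : Nat.card V = 2) : IsReflectionComplex (BHypergraph.triv V)
  | reflect {V V' : Type u} (M : BHypergraph V) (hM : IsReflectionComplex M)
      (L X : Set V) (hL : L ∈ M.edges) (hX : X ⊆ L) (τ₁ : V → V') (τ₂ : L → V')
      (hτ : IsGluing (Subtype.val : X → V) (Set.inclusion hX) τ₁ τ₂) :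
      IsReflectionComplex
        (starGlue M (M.sub L) (Subtype.val : X → V) (Set.inclusion hX) τ₁ τ₂)

/-- The frame of a hypergraph: the graph formed by its two-element edges. -/
def frame {V : Type u} (M : BHypergraph V) : SimpleGraph V where
  Adj a b := a ≠ b ∧ ({a, b} : Set V) ∈ M.edges
  symm := ⟨fun a b h => ⟨h.1.symm, Set.pair_comm a b ▸ h.2⟩⟩
  loopless := ⟨fun _ h => h.1 rfl⟩

end BHypergraph

open Classical in
/-- The set function `1_S`, with value `1` on the set `S` and `0` on all other subsets of `V`. -/
def oneAt {V : Type u} (S : Set V) : Set V → ℝ := fun A => if A = S then 1 else 0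

/-- The set function `t_{A,B} = 1_{A ∪ B} - 1_A - 1_B + 1_{A ∩ B}`. -/
def tFun {V : Type u} (A B : Set V) : Set V → ℝ :=
  oneAt (A ∪ B) - oneAt A - oneAt B + oneAt (A ∩ B)

/-- The linear space `W_b` spanned by the set functions `t_{A,B}` with `(A, B) ∈ b`. -/
def WSpace {V : Type u} (b : Set V → Set V → Prop) : Submodule ℝ (Set V → ℝ) :=
  Submodule.span ℝ {t | ∃ A B, b A B ∧ t = tFun A B}

/-- `Q_V`: the sum of the line spanned by `1_∅` and the cone of all non-negative linear
combinations of the set functions `t_{A,B}` and `1_A`. -/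
def QCone (V : Type u) : Set (Set V → ℝ) :=
  (Submodule.span ℝ {oneAt (∅ : Set V)} : Set (Set V → ℝ)) +
    (Submodule.span NNReal
      ({t | ∃ A B : Set V, t = tFun A B} ∪ {t | ∃ A : Set V, t = oneAt A}) : Set (Set V → ℝ))

open Classical in
/-- The set function `h_H(X) = -1_X + ∑_e 1_e - ∑_{v ∈ X} (deg v - 1) 1_{v}`, where `e` runs through
the edges of the graph spanned by `X` in `H` and `deg v` is the degree in that graph. -/
def hFun {V : Type u} [Fintype V] (H : SimpleGraph V) (X : Set V) : Set V → ℝ :=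
  -oneAt X + ∑ e ∈ H.edgeFinset.filter (fun e => (e : Set V) ⊆ X), oneAt (e : Set V)
    - ∑ v ∈ X.toFinset, (((H.neighborSet v ∩ X).ncard : ℝ) - 1) • oneAt {v}

/-- A b-hypergraph with frame `H` is thick if `h_H(V) ∈ W_B + Q_V`. -/
def BHypergraph.IsThick {V : Type u} [Fintype V] (M : BHypergraph V) : Prop :=
  hFun M.frame Set.univ ∈ (WSpace M.rel : Set (Set V → ℝ)) + QCone V

/-- Thick graphs are the frames of thick reflection complexes. -/
def IsThickGraph {V : Type u} [Fintype V] (H : SimpleGraph V) : Prop :=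
  ∃ M : BHypergraph V, M.IsReflectionComplex ∧ M.IsThick ∧ M.frame = H

/-- The homomorphism density `t(H,G)`: the probability that a uniform random map `V(H) → V(G)` is a
homomorphism. -/
def homDensity {V W : Type*} (H : SimpleGraph V) (G : SimpleGraph W) : ℝ :=
  (Nat.card (H →g G) : ℝ) / (Nat.card (V → W) : ℝ)

/-- The graph consisting of a single edge on two vertices. -/
def singleEdge : SimpleGraph (Fin 2) := ⊤

end

/-! The proof is an entropy argument. Suppose `t(e,G) > 0` and let `M` be a reflection complex with
frame `H`. There is a random map `V → V(G)`, with density `q` against the uniform measure, that is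
supported on homomorphisms of `H`, sends every edge of `H` to a uniform random (oriented) edge of
`G`, and makes the two sets of each pair in `B` conditionally independent over their intersection.
It is built along the reflections: each one glues to the current random map a copy of its marginal
on `L`, conditionally independent over `X` (`IsWitness.reflect`).

Let `F S` be the entropy of the marginal on `S`. Then `F ∅ = 0`, `F ≤ 0`, `F` is submodular, and it
is modular on the pairs in `B`. Hence the linear functional `1_S ↦ F S` vanishes on `W_B` and is
non-positive on `Q_V`, so thickness gives `|E(H)| log t(e,G) ≤ F V + ∑ (deg v - 1) F {v}`. The sum
is non-positive because all degrees are at least 1, and `F V ≤ log t(H,G)` because `q` lives on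
homomorphisms. -/

noncomputable section

universe u

/-! ### Averaging out coordinates -/

open scoped BigOperators Classical in
/-- The average of `f` over all maps that agree with `x` on `S`. -/
def condAvg {V W : Type*} [Fintype V] [Fintype W] (S : Set V) (f : (V → W) → ℝ)
    (x : V → W) : ℝ :=
  𝔼 y : V → W, f (S.piecewise x y)

section CondAvg

open scoped BigOperators Classical

variable {V V' W : Type*} [Fintype V] [Fintype V'] [Fintype W]

/-- Swapping the coordinates outside `S` between `y` and `z` is an involution of the set of pairs,
so it preserves the uniform measure. -/
theorem expect_expect_piecewise [Nonempty W] (S : Set V) (f : (V → W) → ℝ) :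
    𝔼 y : V → W, 𝔼 z : V → W, f (S.piecewise y z) = 𝔼 y : V → W, f y := by
  have hinv : Function.Involutive (fun p : (V → W) × (V → W) =>
      (S.piecewise p.1 p.2, S.piecewise p.2 p.1)) := by
    rintro ⟨y, z⟩
    ext v <;> by_cases hv : v ∈ S <;> simp [hv]
  have h := Fintype.expect_equiv hinv.toPerm
    (fun p : (V → W) × (V → W) => f (S.piecewise p.1 p.2)) (fun p => f p.1) (fun p => rfl)
  rw [← Finset.univ_product_univ, Finset.expect_product, Finset.expect_product] at h
  rw [h]
  simp

/-- Exchanging the coordinates of `y` on the range of `ρ` with `z` is an involution of the pairs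
`(y, z)`. -/
theorem expect_comp_injective [Nonempty W] {ρ : V → V'} (hρ : Function.Injective ρ)
    (f : (V → W) → ℝ) : 𝔼 y : V' → W, f (y ∘ ρ) = 𝔼 z : V → W, f z := by
  have hinv₁ : ∀ p : (V' → W) × (V → W), Function.extend ρ p.2 p.1 ∘ ρ = p.2 := fun p => by
    ext v; simp [hρ.extend_apply]
  have hinv : Function.Involutive (fun p : (V' → W) × (V → W) =>
      (Function.extend ρ p.2 p.1, p.1 ∘ ρ)) := by
    rintro ⟨y, z⟩
    refine Prod.ext ?_ (hinv₁ (y, z))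
    funext v
    by_cases hv : ∃ a, ρ a = v
    · obtain ⟨a, rfl⟩ := hv
      simp [hρ.extend_apply]
    · simp [Function.extend_apply' _ _ _ hv]
  have h := Fintype.expect_equiv hinv.toPerm
    (fun p : (V' → W) × (V → W) => f (p.1 ∘ ρ)) (fun p => f p.2) (fun p => rfl)
  rw [← Finset.univ_product_univ, Finset.expect_product, Finset.expect_product] at h
  simpa using h

theorem expect_condAvg [Nonempty W] (S : Set V) (f : (V → W) → ℝ) :
    𝔼 x, condAvg S f x = 𝔼 x, f x :=
  expect_expect_piecewise S f

theorem condAvg_condAvg [Nonempty W] (A B : Set V) (f : (V → W) → ℝ) :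
    condAvg A (condAvg B f) = condAvg (A ∩ B) f := by
  funext x
  have h : condAvg (A ∩ B) f x = 𝔼 y, f ((A ∩ B).piecewise x y) := by
    unfold condAvg
    congr!
  rw [h, ← expect_expect_piecewise B fun y => f ((A ∩ B).piecewise x y)]
  refine Finset.expect_congr rfl fun y _ => Finset.expect_congr rfl fun z _ => ?_
  congr 1
  ext v
  by_cases hA : v ∈ A <;> by_cases hB : v ∈ B <;> simp [hA, hB]

theorem dependsOn_condAvg (S : Set V) (f : (V → W) → ℝ) : DependsOn (condAvg S f) S := by
  intro x y h
  refine Finset.expect_congr rfl fun z _ => ?_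
  congr 1
  ext v
  by_cases hv : v ∈ S
  · simp [hv, h v hv]
  · simp [hv]

theorem condAvg_mul_of_dependsOn {S : Set V} {g : (V → W) → ℝ} (hg : DependsOn g S)
    (f : (V → W) → ℝ) : condAvg S (fun x => f x * g x) = fun x => condAvg S f x * g x := by
  funext x
  unfold condAvg
  rw [Finset.expect_mul]
  refine Finset.expect_congr rfl fun y _ => ?_
  have h : g (S.piecewise x y) = g x := hg fun i hi => Set.piecewise_eq_of_mem S x y hi
  simp only [h]

theorem condAvg_of_dependsOn [Nonempty W] {S : Set V} {g : (V → W) → ℝ} (hg : DependsOn g S) :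
    condAvg S g = g := by
  funext x
  unfold condAvg
  rw [Finset.expect_congr rfl fun y _ => hg (y := x) fun i hi => by simp [hi]]
  simp

theorem condAvg_inter_of_dependsOn [Nonempty W] {S : Set V} {g : (V → W) → ℝ}
    (hg : DependsOn g S) (T : Set V) : condAvg T g = condAvg (T ∩ S) g := by
  conv_lhs => rw [← condAvg_of_dependsOn hg, condAvg_condAvg]

theorem expect_mul_of_dependsOn [Nonempty W] {S : Set V} {g : (V → W) → ℝ} (hg : DependsOn g S)
    (f : (V → W) → ℝ) : 𝔼 x, f x * g x = 𝔼 x, condAvg S f x * g x := by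
  rw [← expect_condAvg S fun x => f x * g x, condAvg_mul_of_dependsOn hg]

theorem condAvg_nonneg {f : (V → W) → ℝ} (hf : ∀ x, 0 ≤ f x) (S : Set V) (x : V → W) :
    0 ≤ condAvg S f x :=
  Finset.expect_nonneg fun _ _ => hf _

theorem eq_zero_of_condAvg_eq_zero {f : (V → W) → ℝ} (hf : ∀ x, 0 ≤ f x) {S : Set V}
    {x : V → W} (h : condAvg S f x = 0) : f x = 0 := by
  -- The term `y = x` of the average is `f x`, since `S.piecewise x x = x`.
  have := (Finset.expect_eq_zero_iff_of_nonneg (fun _ _ => hf _)).1 h x (Finset.mem_univ _)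
  simpa using this

theorem condAvg_pos {f : (V → W) → ℝ} (hf : ∀ x, 0 ≤ f x) (S : Set V)
    {x : V → W} (h : f x ≠ 0) : 0 < condAvg S f x :=
  (condAvg_nonneg hf S x).lt_of_ne' fun h0 => h (eq_zero_of_condAvg_eq_zero hf h0)

theorem condAvg_comp [Nonempty W] {ρ : V → V'} (hρ : Function.Injective ρ) (f : (V → W) → ℝ)
    (S : Set V') (x : V' → W) :
    condAvg S (fun x => f (x ∘ ρ)) x = condAvg (ρ ⁻¹' S) f (x ∘ ρ) := by
  unfold condAvg
  rw [← expect_comp_injective hρ]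
  refine Finset.expect_congr rfl fun y _ => ?_
  congr 1

theorem condAvg_empty (f : (V → W) → ℝ) (x : V → W) : condAvg ∅ f x = 𝔼 y, f y := by
  simp [condAvg]

theorem condAvg_univ [Nonempty W] (f : (V → W) → ℝ) : condAvg Set.univ f = f :=
  condAvg_of_dependsOn (dependsOn_univ f)

/-! ### Entropy of marginals -/

/-- The entropy of the marginal on `S` of the density `q`, relative to the uniform measure. -/
def ent (q : (V → W) → ℝ) (S : Set V) : ℝ :=
  -𝔼 x, q x * Real.log (condAvg S q x)

theorem ent_eq_condAvg [Nonempty W] (q : (V → W) → ℝ) (S : Set V) :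
    ent q S = -𝔼 x, condAvg S q x * Real.log (condAvg S q x) := by
  unfold ent
  rw [expect_mul_of_dependsOn (g := fun x => Real.log (condAvg S q x)) (S := S)]
  intro x y h
  simp only [dependsOn_condAvg S q h]

/-- Gibbs' inequality, from `log u ≤ u - 1`. The entropy inequalities below all follow from it by a
choice of `u`; points with `q x = 0` contribute nothing, so `u` need only be positive on the
support. -/
theorem expect_mul_log_nonpos {q u : (V → W) → ℝ} (hq : ∀ x, 0 ≤ q x) (hq1 : 𝔼 x, q x = 1)
    (hu : ∀ x, q x ≠ 0 → 0 < u x) (h : 𝔼 x, q x * u x ≤ 1) :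
    𝔼 x, q x * Real.log (u x) ≤ 0 := by
  have h1 : 𝔼 x, q x * Real.log (u x) ≤ 𝔼 x, (q x * u x - q x) := by
    refine Finset.expect_le_expect fun x _ => ?_
    by_cases hx : q x = 0
    · simp [hx]
    · nlinarith [hq x, Real.log_le_sub_one_of_pos (hu x hx)]
  rw [Finset.expect_sub_distrib, hq1] at h1
  linarith

theorem ent_empty {q : (V → W) → ℝ} (hq1 : 𝔼 x, q x = 1) : ent q ∅ = 0 := by
  simp [ent, condAvg_empty, hq1]

theorem ent_nonpos [Nonempty W] {q : (V → W) → ℝ} (hq : ∀ x, 0 ≤ q x) (hq1 : 𝔼 x, q x = 1)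
    (S : Set V) : ent q S ≤ 0 := by
  have h := expect_mul_log_nonpos (u := fun x => (condAvg S q x)⁻¹) hq hq1
    (fun x hx => inv_pos.2 (condAvg_pos hq S hx)) (by
      rw [expect_mul_of_dependsOn (S := S) fun x y h => by simp only [dependsOn_condAvg S q h]]
      -- Only `≤ 1` holds pointwise, because `0⁻¹ = 0` where the marginal vanishes.
      rw [← Fintype.expect_const (ι := V → W) (1 : ℝ)]
      exact Finset.expect_le_expect fun x _ => mul_inv_le_one)
  simpa [ent, Real.log_inv] using h

theorem ent_submodular [Nonempty W] {q : (V → W) → ℝ} (hq : ∀ x, 0 ≤ q x)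
    (hq1 : 𝔼 x, q x = 1) (A B : Set V) :
    ent q (A ∪ B) + ent q (A ∩ B) ≤ ent q A + ent q B := by
  -- The density of the conditionally independent coupling of the marginals on `A` and `B`, divided
  -- by the marginal on `A ∪ B`. Averaging down to `A ∪ B` and then to `A` cancels the two inverses
  -- in turn.
  set u : (V → W) → ℝ := fun x => condAvg A q x * condAvg B q x * (condAvg (A ∩ B) q x)⁻¹ *
    (condAvg (A ∪ B) q x)⁻¹ with hu
  have hdep : ∀ S T : Set V, S ⊆ T → ∀ x y : V → W, (∀ i ∈ T, x i = y i) →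
      condAvg S q x = condAvg S q y := fun S T h x y hxy =>
    dependsOn_condAvg S q fun i hi => hxy i (h hi)
  have hE : 𝔼 x, q x * u x ≤ 1 := by
    rw [expect_mul_of_dependsOn (S := A ∪ B) fun x y h => by
      simp only [hu, hdep _ _ Set.subset_union_left x y h, hdep _ _ Set.subset_union_right x y h,
        hdep _ _ subset_rfl x y h,
        hdep _ _ (Set.inter_subset_left.trans Set.subset_union_left) x y h]]
    calc _ ≤ 𝔼 x, condAvg B q x * (condAvg A q x * (condAvg (A ∩ B) q x)⁻¹) := by
          refine Finset.expect_le_expect fun x _ => ?_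
          have h0 : 0 ≤ condAvg A q x * condAvg B q x * (condAvg (A ∩ B) q x)⁻¹ :=
            mul_nonneg (mul_nonneg (condAvg_nonneg hq _ _) (condAvg_nonneg hq _ _))
              (inv_nonneg.2 (condAvg_nonneg hq _ _))
          have h1 := mul_le_mul_of_nonneg_left (mul_inv_le_one (a := condAvg (A ∪ B) q x)) h0
          simp only [hu]
          linarith
      _ = 𝔼 x, condAvg (A ∩ B) q x * (condAvg A q x * (condAvg (A ∩ B) q x)⁻¹) := by
          rw [expect_mul_of_dependsOn (S := A) fun x y h => by
            simp only [hdep _ _ subset_rfl x y h, hdep _ _ Set.inter_subset_left x y h],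
            condAvg_condAvg]
      _ ≤ 𝔼 x, condAvg A q x := by
          refine Finset.expect_le_expect fun x _ => ?_
          have h1 := mul_le_mul_of_nonneg_left (mul_inv_le_one (a := condAvg (A ∩ B) q x))
            (condAvg_nonneg hq A x)
          linarith
      _ = 1 := by rw [expect_condAvg, hq1]
  have h := expect_mul_log_nonpos hq hq1 (u := u) (fun x hx => by
    have := fun S => condAvg_pos hq S hx
    have h1 := this A; have h2 := this B; have h3 := this (A ∩ B); have h4 := this (A ∪ B)
    positivity) hE
  have h2 : 𝔼 x, q x * Real.log (u x) =
      -ent q A - ent q B + ent q (A ∩ B) + ent q (A ∪ B) := by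
    simp only [ent, ← Finset.expect_neg_distrib, ← Finset.expect_add_distrib,
      ← Finset.expect_sub_distrib]
    refine Finset.expect_congr rfl fun x _ => ?_
    by_cases hx : q x = 0
    · simp [hx]
    have := fun S => condAvg_pos hq S hx
    rw [Real.log_mul, Real.log_mul, Real.log_mul, Real.log_inv, Real.log_inv]
    · ring
    all_goals have h1 := this A; have h2 := this B; have h3 := this (A ∩ B); have h4 := this (A ∪ B)
              positivity
  linarith

theorem ent_modular_of_mul_eq_mul {q : (V → W) → ℝ} (hq : ∀ x, 0 ≤ q x) {A B : Set V}
    (h : ∀ x, condAvg (A ∪ B) q x * condAvg (A ∩ B) q x = condAvg A q x * condAvg B q x) :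
    ent q (A ∪ B) + ent q (A ∩ B) = ent q A + ent q B := by
  simp only [ent, ← Finset.expect_neg_distrib, ← Finset.expect_add_distrib]
  refine Finset.expect_congr rfl fun x _ => ?_
  by_cases hx : q x = 0
  · simp [hx]
  have := fun S => (condAvg_pos hq S hx).ne'
  have h2 := congrArg Real.log (h x)
  rw [Real.log_mul (this _) (this _), Real.log_mul (this _) (this _)] at h2
  linear_combination -q x * h2

theorem ent_image [Nonempty W] {ρ : V → V'} (hρ : Function.Injective ρ)
    {q : (V → W) → ℝ} {q' : (V' → W) → ℝ} {S : Set V}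
    (h : ∀ x, condAvg (ρ '' S) q' x = condAvg S q (x ∘ ρ)) : ent q' (ρ '' S) = ent q S := by
  rw [ent_eq_condAvg, ent_eq_condAvg, ← expect_comp_injective hρ]
  simp only [h]

/-- The uniform distribution on a set maximises entropy: Gibbs' inequality with `u = 1 / (q s)`,
where `s` is the measure of `P`. -/
theorem ent_univ_le_log [Nonempty W] {q : (V → W) → ℝ} (hq : ∀ x, 0 ≤ q x)
    (hq1 : 𝔼 x, q x = 1) {P : (V → W) → Prop} (hP : ∀ x, q x ≠ 0 → P x) :
    ent q Set.univ ≤ Real.log (𝔼 x, if P x then (1 : ℝ) else 0) := by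
  set s : ℝ := 𝔼 x, if P x then (1 : ℝ) else 0 with hs
  obtain ⟨x₀, hx₀⟩ : ∃ x, q x ≠ 0 := by
    by_contra! h
    simp [h] at hq1
  have hs0 : 0 < s := Finset.expect_pos' (fun x _ => by split_ifs <;> norm_num)
    ⟨x₀, Finset.mem_univ _, by simp [hP x₀ hx₀]⟩
  have hpos : ∀ x, q x ≠ 0 → 0 < q x := fun x hx => (hq x).lt_of_ne' hx
  have h := expect_mul_log_nonpos (u := fun x => (q x)⁻¹ * s⁻¹) hq hq1 (fun x hx => by
    have := hpos x hx
    positivity) (by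
      calc 𝔼 x, q x * ((q x)⁻¹ * s⁻¹) ≤ 𝔼 x, (if P x then (1 : ℝ) else 0) * s⁻¹ := by
            refine Finset.expect_le_expect fun x _ => ?_
            by_cases hx : q x = 0
            · simp only [hx, zero_mul]
              split_ifs <;> positivity
            · rw [if_pos (hP x hx), mul_inv_cancel_left₀ hx, one_mul]
        _ = 1 := by rw [← Finset.expect_mul, ← hs, mul_inv_cancel₀ hs0.ne'])
  have h2 : 𝔼 x, q x * Real.log ((q x)⁻¹ * s⁻¹) = ent q Set.univ - Real.log s := by
    rw [← one_mul (Real.log s), ← hq1, Finset.expect_mul]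
    simp only [ent, condAvg_univ, ← Finset.expect_neg_distrib, ← Finset.expect_sub_distrib]
    refine Finset.expect_congr rfl fun x _ => ?_
    by_cases hx : q x = 0
    · simp [hx]
    rw [Real.log_mul (inv_ne_zero hx) (inv_ne_zero hs0.ne'), Real.log_inv, Real.log_inv]
    ring
  linarith

/-! ### Conditionally independent couplings -/

section CondProduct

variable {A B : Set V} {a b c : (V → W) → ℝ}

/-- `a * b / c` couples a density `a` on `A` with a density `b` on `B` that share the marginal `c`.
Division by zero is harmless: `c x = 0` forces `a x = 0`. -/
theorem condAvg_condProduct (ha0 : ∀ x, 0 ≤ a x) (ha : DependsOn a A)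
    (hca : condAvg B a = c) (hcb : condAvg A b = c) :
    condAvg A (fun x => a x * b x / c x) = a := by
  have hdc : DependsOn c A := hcb ▸ dependsOn_condAvg A b
  have h := condAvg_mul_of_dependsOn (S := A) (g := fun x => a x / c x)
    (fun x y h => by simp only [ha h, hdc h]) b
  have e : (fun x => a x * b x / c x) = fun x => b x * (a x / c x) := by
    funext x; ring
  rw [e, h, hcb]
  funext x
  by_cases hx : c x = 0
  · rw [hx, zero_mul, eq_zero_of_condAvg_eq_zero ha0 (by rw [hca, hx])]
  · rw [mul_div_cancel₀ _ hx]

/-- Conditional independence passes to all `S` and `T` that contain the overlap: average out the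
part of `B` off `T`, then the part of `A` off `S`, while `c` stays fixed. This is the product
formula that makes the entropy modular on pairs of the second type. -/
theorem condAvg_union_condProduct [Nonempty W] (ha0 : ∀ x, 0 ≤ a x) (ha : DependsOn a A)
    (hb : DependsOn b B) (hca : condAvg B a = c) (hcb : condAvg A b = c)
    {S T : Set V} (hSA : S ⊆ A) (hTB : T ⊆ B) (hS : A ∩ B ⊆ S) (hT : A ∩ B ⊆ T) (x : V → W) :
    condAvg (S ∪ T) (fun x => a x * b x / c x) x * c x = condAvg S a x * condAvg T b x := by
  have hdc : DependsOn c (A ∩ B) := by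
    rw [← hcb, condAvg_inter_of_dependsOn hb]
    exact dependsOn_condAvg _ _
  have h1 : condAvg (A ∪ T) (fun x => b x * a x) = fun x => condAvg T b x * a x := by
    have h : DependsOn a (A ∪ T) := fun x y h => ha fun i hi => h i (Or.inl hi)
    rw [condAvg_mul_of_dependsOn h,
      condAvg_inter_of_dependsOn hb]
    congr! 4
    ext v
    have := @hT v
    have := @hTB v
    simp only [Set.mem_inter_iff, Set.mem_union] at *
    tauto
  have h2 : condAvg (S ∪ B) (fun x => a x * condAvg T b x) =
      fun x => condAvg S a x * condAvg T b x := by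
    have h : DependsOn (condAvg T b) (S ∪ B) := fun x y h => dependsOn_condAvg T b fun i hi =>
      h i (Or.inr (hTB hi))
    rw [condAvg_mul_of_dependsOn h, condAvg_inter_of_dependsOn ha]
    congr! 4
    ext v
    have := @hS v
    have := @hSA v
    simp only [Set.mem_inter_iff, Set.mem_union] at *
    tauto
  have h3 : (S ∪ B) ∩ (A ∪ T) = S ∪ T := by
    ext v
    have := @hS v
    have := @hSA v
    have := @hT v
    have := @hTB v
    simp only [Set.mem_inter_iff, Set.mem_union] at *
    tauto
  have h4 : condAvg (S ∪ T) (fun x => b x * a x) = fun x => condAvg S a x * condAvg T b x := by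
    rw [← h3, ← condAvg_condAvg, h1, ← h2]
    simp only [mul_comm]
  have h5 := condAvg_mul_of_dependsOn (S := S ∪ T) (g := fun x => (c x)⁻¹)
    (fun x y h => by simp only [hdc fun i hi => h i (Or.inl (hS hi))]) (fun x => b x * a x)
  have e : (fun x => a x * b x / c x) = fun x => b x * a x * (c x)⁻¹ := by
    funext x; ring
  rw [e, h5, h4]
  by_cases hx : c x = 0
  · have : condAvg S a x = 0 := by
      refine eq_zero_of_condAvg_eq_zero (f := condAvg S a) (S := B)
        (fun _ => condAvg_nonneg ha0 _ _) ?_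
      rw [condAvg_condAvg]
      have h6 : c x = condAvg (B ∩ S) a x := by
        rw [← hca, condAvg_inter_of_dependsOn ha]
        congr! 1
        ext v
        have := @hS v
        have := @hSA v
        simp only [Set.mem_inter_iff] at *
        tauto
      rw [← h6, hx]
    rw [hx, this]; simp
  · simp only
    rw [mul_assoc, inv_mul_cancel₀ hx, mul_one]

end CondProduct

end CondAvg

/-! ### Witness densities and the trivial complex -/

section Witness

open scoped BigOperators Classical

/-- The density `q` on the maps `V → W` certifies the entropy bounds for the b-hypergraph `M`:
pairs that are edges of `M` are distributed as a uniform random edge of `G`, and the relation of `M`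
consists of conditionally independent pairs. -/
structure BHypergraph.IsWitness {V : Type u} {W : Type*} [Fintype V] [Fintype W]
    (M : BHypergraph V) (G : SimpleGraph W) (q : (V → W) → ℝ) : Prop where
  nonneg : ∀ x, 0 ≤ q x
  expect_eq_one : 𝔼 x, q x = 1
  adj : ∀ a b, M.frame.Adj a b → ∀ x, q x ≠ 0 → G.Adj (x a) (x b)
  ent_pair : ∀ a b, M.frame.Adj a b → ent q {a, b} = Real.log (homDensity singleEdge G)
  modular : ∀ A B, M.rel A B → ent q (A ∪ B) + ent q (A ∩ B) = ent q A + ent q B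

/-- Every vertex of every edge lies in a two-element edge that this edge contains, and the edges
cover the vertex set. -/
structure BHypergraph.PairCovered {V : Type u} (M : BHypergraph V) : Prop where
  exists_pair : ∀ K ∈ M.edges, ∀ a ∈ K, ∃ b ∈ K, M.frame.Adj a b
  exists_edge : ∀ a, ∃ K ∈ M.edges, a ∈ K

variable {V V' : Type u} {W : Type*}

theorem homDensity_singleEdge_eq_expect [Fintype V] [Fintype W] {a b : V} (hab : a ≠ b)
    (hV : ∀ v, v = a ∨ v = b) (G : SimpleGraph W) :
    homDensity singleEdge G = 𝔼 x : V → W, if G.Adj (x a) (x b) then (1 : ℝ) else 0 := by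
  let e : Fin 2 ≃ V := Equiv.ofBijective ![a, b] (by
    constructor
    · intro i j
      fin_cases i <;> fin_cases j <;> simp [hab, hab.symm]
    · intro v
      rcases hV v with rfl | rfl
      exacts [⟨0, rfl⟩, ⟨1, rfl⟩])
  let f : (singleEdge →g G) ≃ {x : V → W // G.Adj (x a) (x b)} :=
    { toFun := fun φ => ⟨fun v => φ (e.symm v), by
        apply φ.map_adj
        simp only [singleEdge, SimpleGraph.top_adj, ne_eq, EmbeddingLike.apply_eq_iff_eq]
        exact hab⟩
      invFun := fun x => ⟨fun i => x.1 (e i), by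
        intro i j hij
        have hij : i ≠ j := hij
        fin_cases i <;> fin_cases j
        · exact absurd rfl hij
        · exact x.2
        · exact x.2.symm
        · exact absurd rfl hij⟩
      left_inv := fun φ => by ext i; simp
      right_inv := fun x => by ext i; simp }
  rw [homDensity, Nat.card_congr f, Nat.card_congr (e.arrowCongr (Equiv.refl W)),
    Fintype.expect_eq_sum_div_card, Finset.sum_boole, Nat.card_eq_fintype_card,
    Nat.card_eq_fintype_card, Fintype.card_subtype]

theorem homDensity_eq_expect {V W : Type*} [Fintype V] [Fintype W] (H : SimpleGraph V)
    (G : SimpleGraph W) :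
    homDensity H G =
      𝔼 x : V → W, if ∀ a b, H.Adj a b → G.Adj (x a) (x b) then (1 : ℝ) else 0 := by
  let f : (H →g G) ≃ {x : V → W // ∀ a b, H.Adj a b → G.Adj (x a) (x b)} :=
    { toFun := fun φ => ⟨φ, fun a b h => φ.map_adj h⟩
      invFun := fun x => ⟨x.1, fun h => x.2 _ _ h⟩
      left_inv := fun φ => rfl
      right_inv := fun x => rfl }
  rw [homDensity, Nat.card_congr f,
    Fintype.expect_eq_sum_div_card, Finset.sum_boole, Nat.card_eq_fintype_card,
    Nat.card_eq_fintype_card, Fintype.card_subtype]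

namespace BHypergraph

theorem pairCovered_triv (hV : Nat.card V = 2) : (triv V).PairCovered := by
  obtain ⟨a, b, hab, hu⟩ := Nat.card_eq_two_iff.1 hV
  have huv : ∀ v, v = a ∨ v = b := fun v => by
    have : v ∈ ({a, b} : Set V) := hu ▸ Set.mem_univ v
    simpa using this
  refine ⟨?_, fun v => ⟨Set.univ, rfl, trivial⟩⟩
  rintro K rfl v -
  rcases huv v with rfl | rfl
  · exact ⟨b, trivial, hab, hu⟩
  · exact ⟨a, trivial, hab.symm, Set.pair_comm a v ▸ hu⟩

theorem exists_isWitness_triv [Fintype V] [Fintype W] [Nonempty W] (hV : Nat.card V = 2)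
    (G : SimpleGraph W) (hG : 0 < homDensity singleEdge G) :
    ∃ q, (triv V).IsWitness G q := by
  obtain ⟨a, b, hab, hu⟩ := Nat.card_eq_two_iff.1 hV
  have huv : ∀ v, v = a ∨ v = b := fun v => by
    have : v ∈ ({a, b} : Set V) := hu ▸ Set.mem_univ v
    simpa using this
  have ht := homDensity_singleEdge_eq_expect hab huv G
  set t := homDensity singleEdge G
  have h1 : 𝔼 x : V → W, (if G.Adj (x a) (x b) then (1 : ℝ) else 0) * t⁻¹ = 1 := by
    rw [← Finset.expect_mul, ← ht, mul_inv_cancel₀ hG.ne']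
  -- The uniform distribution on oriented edges of `G`; on its support the density is the constant
  -- `t⁻¹`, so its entropy is `log t`.
  refine ⟨fun x => (if G.Adj (x a) (x b) then (1 : ℝ) else 0) * t⁻¹,
    fun x => by positivity, h1, ?_, ?_, fun _ _ h => h.elim⟩
  · intro c d hcd x hx
    have hx : G.Adj (x a) (x b) := by
      by_contra h
      simp [h] at hx
    have hne := hcd.1
    rcases huv c with rfl | rfl <;> rcases huv d with rfl | rfl
    · exact absurd rfl hne
    · exact hx
    · exact hx.symm
    · exact absurd rfl hne
  · intro c d hcd
    have hcu : ({c, d} : Set V) = Set.univ := hcd.2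
    rw [hcu, ent, condAvg_univ]
    have : ∀ x : V → W, (if G.Adj (x a) (x b) then (1 : ℝ) else 0) * t⁻¹ *
        Real.log ((if G.Adj (x a) (x b) then (1 : ℝ) else 0) * t⁻¹) =
        (if G.Adj (x a) (x b) then (1 : ℝ) else 0) * t⁻¹ * Real.log t⁻¹ := by
      intro x
      split_ifs <;> simp
    simp only [this]
    rw [← Finset.expect_mul, h1, Real.log_inv]
    ring

/-! ### Reflections preserve witnesses -/

section Reflect

variable {M : BHypergraph V} {L X : Set V} {hX : X ⊆ L} {τ₁ : V → V'} {τ₂ : L → V'}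

/-- A union `τ₁ '' K₁ ∪ τ₂ '' K₂` may have two elements, but it creates no new frame edge: a copy
containing `a` also contains a frame neighbour of `a`, which must then be `b`. -/
theorem frame_adj_starGlue {V₁ V₂ F : Type u} {M₁ : BHypergraph V₁} {M₂ : BHypergraph V₂}
    {φ₁ : F → V₁} {φ₂ : F → V₂} {τ₁ : V₁ → V} {τ₂ : V₂ → V} (hτ : IsGluing φ₁ φ₂ τ₁ τ₂) {a b : V} :
    (starGlue M₁ M₂ φ₁ φ₂ τ₁ τ₂).frame.Adj a b → (∀ K ∈ M₁.edges, ∀ a ∈ K, ∃ b ∈ K,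
      M₁.frame.Adj a b) → (∀ K ∈ M₂.edges, ∀ a ∈ K, ∃ b ∈ K, M₂.frame.Adj a b) →
    (∃ c d, M₁.frame.Adj c d ∧ a = τ₁ c ∧ b = τ₁ d) ∨
      ∃ c d, M₂.frame.Adj c d ∧ a = τ₂ c ∧ b = τ₂ d := by
  rintro ⟨hab, hK⟩ h₁ h₂
  -- The three kinds of edges are treated together by letting `K₁` or `K₂` be empty.
  obtain ⟨K₁, hK₁, K₂, hK₂, ha, hu⟩ : ∃ K₁, (∀ a ∈ K₁, ∃ b ∈ K₁, M₁.frame.Adj a b) ∧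
      ∃ K₂, (∀ a ∈ K₂, ∃ b ∈ K₂, M₂.frame.Adj a b) ∧ a ∈ τ₁ '' K₁ ∪ τ₂ '' K₂ ∧
        τ₁ '' K₁ ∪ τ₂ '' K₂ ⊆ {a, b} := by
    rcases hK with ⟨K₁, hK₁, h⟩ | ⟨K₂, hK₂, h⟩ | ⟨K₁, hK₁, K₂, hK₂, -, -, h⟩
    · exact ⟨K₁, h₁ K₁ hK₁, ∅, by simp, by simp [← h], by simp [← h]⟩
    · exact ⟨∅, by simp, K₂, h₂ K₂ hK₂, by simp [← h], by simp [← h]⟩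
    · exact ⟨K₁, h₁ K₁ hK₁, K₂, h₂ K₂ hK₂, by simp [← h], h.ge⟩
  rcases ha with ⟨c, hc, rfl⟩ | ⟨c, hc, rfl⟩
  · obtain ⟨d, hd, hcd⟩ := hK₁ c hc
    rcases hu (Or.inl ⟨d, hd, rfl⟩) with h | h
    · exact absurd (hτ.inj₁ h).symm hcd.1
    · exact Or.inl ⟨c, d, hcd, rfl, h.symm⟩
  · obtain ⟨d, hd, hcd⟩ := hK₂ c hc
    rcases hu (Or.inr ⟨d, hd, rfl⟩) with h | h
    · exact absurd (hτ.inj₂ h).symm hcd.1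
    · exact Or.inr ⟨c, d, hcd, rfl, h.symm⟩

theorem frame_adj_sub {M : BHypergraph V} {L : Set V} {a b : L} :
    (M.sub L).frame.Adj a b ↔ M.frame.Adj a b := by
  simp [frame, sub, Set.image_pair, Subtype.ext_iff]

theorem PairCovered.sub_exists_pair (hM : M.PairCovered) (L : Set V) :
    ∀ K ∈ (M.sub L).edges, ∀ a ∈ K, ∃ b ∈ K, (M.sub L).frame.Adj a b := by
  intro K hK a ha
  obtain ⟨_, ⟨b, hb, rfl⟩, hab⟩ := hM.exists_pair _ hK a ⟨a, ha, rfl⟩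
  exact ⟨b, hb, frame_adj_sub.2 hab⟩

theorem frame_adj_starGlue_left {V₁ V₂ F : Type u} {M₁ : BHypergraph V₁} {M₂ : BHypergraph V₂}
    {φ₁ : F → V₁} {φ₂ : F → V₂} {τ₁ : V₁ → V} {τ₂ : V₂ → V} (hτ : IsGluing φ₁ φ₂ τ₁ τ₂) {a b : V₁}
    (h : M₁.frame.Adj a b) : (starGlue M₁ M₂ φ₁ φ₂ τ₁ τ₂).frame.Adj (τ₁ a) (τ₁ b) :=
  ⟨hτ.inj₁.ne h.1, Or.inl ⟨_, h.2, (Set.image_pair _ _ _).symm⟩⟩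

theorem frame_adj_starGlue_right {V₁ V₂ F : Type u} {M₁ : BHypergraph V₁} {M₂ : BHypergraph V₂}
    {φ₁ : F → V₁} {φ₂ : F → V₂} {τ₁ : V₁ → V} {τ₂ : V₂ → V} (hτ : IsGluing φ₁ φ₂ τ₁ τ₂) {a b : V₂}
    (h : M₂.frame.Adj a b) : (starGlue M₁ M₂ φ₁ φ₂ τ₁ τ₂).frame.Adj (τ₂ a) (τ₂ b) :=
  ⟨hτ.inj₂.ne h.1, Or.inr (Or.inl ⟨_, h.2, (Set.image_pair _ _ _).symm⟩)⟩

theorem PairCovered.reflect (hM : M.PairCovered) (hL : L ∈ M.edges)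
    (hτ : IsGluing (Subtype.val : X → V) (Set.inclusion hX) τ₁ τ₂) :
    (starGlue M (M.sub L) (Subtype.val : X → V) (Set.inclusion hX) τ₁ τ₂).PairCovered := by
  have h₁ : ∀ K ∈ M.edges, ∀ a ∈ τ₁ '' K, ∃ b ∈ τ₁ '' K, (starGlue M (M.sub L)
      (Subtype.val : X → V) (Set.inclusion hX) τ₁ τ₂).frame.Adj a b := by
    rintro K hK _ ⟨a, ha, rfl⟩
    obtain ⟨b, hb, hab⟩ := hM.exists_pair K hK a ha
    exact ⟨τ₁ b, ⟨b, hb, rfl⟩, frame_adj_starGlue_left hτ hab⟩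
  have h₂ : ∀ K ∈ (M.sub L).edges, ∀ a ∈ τ₂ '' K, ∃ b ∈ τ₂ '' K, (starGlue M (M.sub L)
      (Subtype.val : X → V) (Set.inclusion hX) τ₁ τ₂).frame.Adj a b := by
    rintro K hK _ ⟨a, ha, rfl⟩
    obtain ⟨b, hb, hab⟩ := hM.sub_exists_pair L K hK a ha
    exact ⟨τ₂ b, ⟨b, hb, rfl⟩, frame_adj_starGlue_right hτ hab⟩
  constructor
  · rintro K (⟨K₁, hK₁, rfl⟩ | ⟨K₂, hK₂, rfl⟩ | ⟨K₁, hK₁, K₂, hK₂, -, -, rfl⟩) a ha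
    · exact h₁ K₁ hK₁ a ha
    · exact h₂ K₂ hK₂ a ha
    · rcases ha with ha | ha
      · obtain ⟨b, hb, hab⟩ := h₁ K₁ hK₁ a ha
        exact ⟨b, Or.inl hb, hab⟩
      · obtain ⟨b, hb, hab⟩ := h₂ K₂ hK₂ a ha
        exact ⟨b, Or.inr hb, hab⟩
  · intro v
    have hv : v ∈ Set.range τ₁ ∪ Set.range τ₂ := hτ.cover ▸ Set.mem_univ v
    rcases hv with ⟨a, rfl⟩ | ⟨a, rfl⟩
    · obtain ⟨K, hK, ha⟩ := hM.exists_edge a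
      exact ⟨τ₁ '' K, Or.inl ⟨K, hK, rfl⟩, a, ha, rfl⟩
    · refine ⟨τ₂ '' Set.univ, Or.inr (Or.inl ⟨Set.univ, ?_, rfl⟩), a, trivial, rfl⟩
      simpa [sub] using hL

/-- The extension of `τ₂` to all of `V` by `τ₁`. -/
def extendGlue (τ₁ : V → V') (τ₂ : L → V') (v : V) : V' :=
  if h : v ∈ L then τ₂ ⟨v, h⟩ else τ₁ v

theorem extendGlue_coe (τ₁ : V → V') (τ₂ : L → V') (v : L) : extendGlue τ₁ τ₂ v = τ₂ v := by
  simp [extendGlue]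

theorem image_extendGlue (τ₁ : V → V') (τ₂ : L → V') (K : Set L) :
    extendGlue τ₁ τ₂ '' (Subtype.val '' K) = τ₂ '' K := by
  simp only [Set.image_image, extendGlue_coe]

theorem IsGluing.apply_eq_apply_iff
    (hτ : IsGluing (Subtype.val : X → V) (Set.inclusion hX) τ₁ τ₂) (v : V) (w : L) :
    τ₁ v = τ₂ w ↔ v = w ∧ v ∈ X := by
  rw [hτ.eq_iff]
  constructor
  · rintro ⟨f, rfl, rfl⟩
    exact ⟨rfl, f.2⟩
  · rintro ⟨rfl, h⟩
    exact ⟨⟨w, h⟩, rfl, rfl⟩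

/-- Injectivity on all of `V` lets the marginal of `q` on `L` be transported as a function on `V →
W`, without passing to functions on `L → W`. -/
theorem extendGlue_injective
    (hτ : IsGluing (Subtype.val : X → V) (Set.inclusion hX) τ₁ τ₂) :
    Function.Injective (extendGlue τ₁ τ₂) := by
  intro v w h
  unfold extendGlue at h
  split_ifs at h with hv hw hw
  · simpa using hτ.inj₂ h
  · exact ((hτ.apply_eq_apply_iff _ _).1 h.symm).1.symm
  · exact ((hτ.apply_eq_apply_iff _ _).1 h).1
  · exact hτ.inj₁ h

theorem extendGlue_of_mem
    (hτ : IsGluing (Subtype.val : X → V) (Set.inclusion hX) τ₁ τ₂) {v : V} (hv : v ∈ X) : extendGlue τ₁ τ₂ v = τ₁ v := by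
  rw [extendGlue, dif_pos (hX hv), eq_comm, hτ.apply_eq_apply_iff]
  exact ⟨rfl, hv⟩

theorem preimage_range_right
    (hτ : IsGluing (Subtype.val : X → V) (Set.inclusion hX) τ₁ τ₂) :
    τ₁ ⁻¹' Set.range τ₂ = X := by
  ext v
  constructor
  · rintro ⟨w, hw⟩
    exact ((hτ.apply_eq_apply_iff _ _).1 hw.symm).2
  · intro hv
    exact ⟨⟨v, hX hv⟩, ((hτ.apply_eq_apply_iff _ _).2 ⟨rfl, hv⟩).symm⟩

theorem preimage_range_left_inter
    (hτ : IsGluing (Subtype.val : X → V) (Set.inclusion hX) τ₁ τ₂) :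
    extendGlue τ₁ τ₂ ⁻¹' Set.range τ₁ ∩ L = X := by
  ext v
  constructor
  · rintro ⟨⟨w, hw⟩, hv⟩
    rw [extendGlue, dif_pos hv, hτ.apply_eq_apply_iff] at hw
    have hwv : w = v := hw.1
    exact hwv ▸ hw.2
  · intro hv
    exact ⟨⟨v, (extendGlue_of_mem hτ hv).symm⟩, hX hv⟩

/-- The conditionally independent coupling over `X` of `q` and a copy of its marginal on `L`. -/
def glueDensity [Fintype V] [Fintype W] (L X : Set V) (τ₁ : V → V') (τ₂ : L → V')
    (q : (V → W) → ℝ) (x : V' → W) : ℝ :=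
  q (x ∘ τ₁) * condAvg L q (x ∘ extendGlue τ₁ τ₂) / condAvg X q (x ∘ τ₁)

/-- The coupling has marginal `q` on the first copy and the `L`-marginal of `q` on the second, so
everything inside one copy is inherited. Relations across the copies are modular by conditional
independence over `X`. -/
theorem IsWitness.reflect [Fintype V] [Fintype V'] [Fintype W] [Nonempty W] {G : SimpleGraph W}
    {q : (V → W) → ℝ} (hq : M.IsWitness G q) (hM : M.PairCovered)
    (hτ : IsGluing (Subtype.val : X → V) (Set.inclusion hX) τ₁ τ₂) :
    (starGlue M (M.sub L) (Subtype.val : X → V) (Set.inclusion hX) τ₁ τ₂).IsWitness G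
      (glueDensity L X τ₁ τ₂ q) := by
  set ρ := extendGlue τ₁ τ₂ with hρ
  have hρi : Function.Injective ρ := extendGlue_injective hτ
  set a : (V' → W) → ℝ := fun x => q (x ∘ τ₁) with ha
  set b : (V' → W) → ℝ := fun x => condAvg L q (x ∘ ρ) with hb
  set c : (V' → W) → ℝ := fun x => condAvg X q (x ∘ τ₁) with hc
  set q' := glueDensity L X τ₁ τ₂ q with hq'
  have hq'e : q' = fun x => a x * b x / c x := rfl
  have ha0 : ∀ x, 0 ≤ a x := fun x => hq.nonneg _
  have hb0 : ∀ x, 0 ≤ b x := fun x => condAvg_nonneg hq.nonneg _ _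
  have hadep : DependsOn a (Set.range τ₁) := fun x y h =>
    congrArg q (funext fun v => h _ ⟨v, rfl⟩)
  have hbdep : DependsOn b (Set.range τ₂) := fun x y h => dependsOn_condAvg L q fun v hv =>
    h _ ⟨⟨v, hv⟩, (extendGlue_coe τ₁ τ₂ ⟨v, hv⟩).symm⟩
  have hca : condAvg (Set.range τ₂) a = c := by
    funext x
    rw [ha, condAvg_comp hτ.inj₁, preimage_range_right hτ]
  have hcb : condAvg (Set.range τ₁) b = c := by
    funext x
    rw [hb, condAvg_comp hρi, condAvg_condAvg, preimage_range_left_inter hτ]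
    exact dependsOn_condAvg X q fun v hv => congrArg x (extendGlue_of_mem hτ hv)
  have hA : condAvg (Set.range τ₁) q' = a := condAvg_condProduct ha0 hadep hca hcb
  have hB : condAvg (Set.range τ₂) q' = b := by
    rw [hq'e]
    simp only [mul_comm (a _)]
    exact condAvg_condProduct hb0 hbdep hcb hca
  have hA' : ∀ S ⊆ Set.range τ₁, condAvg S q' = condAvg S a := fun S hS => by
    rw [← hA, condAvg_condAvg, Set.inter_eq_left.2 hS]
  have hB' : ∀ S ⊆ Set.range τ₂, condAvg S q' = condAvg S b := fun S hS => by
    rw [← hB, condAvg_condAvg, Set.inter_eq_left.2 hS]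
  have h₁ : ∀ (S : Set V) x, condAvg (τ₁ '' S) q' x = condAvg S q (x ∘ τ₁) := fun S x => by
    rw [hA' _ (Set.image_subset_range _ _), ha, condAvg_comp hτ.inj₁,
      Set.preimage_image_eq _ hτ.inj₁]
  have h₂ : ∀ (S : Set L) x,
      condAvg (ρ '' (Subtype.val '' S)) q' x = condAvg (Subtype.val '' S) q (x ∘ ρ) := fun S x => by
    rw [image_extendGlue, hB' _ (Set.image_subset_range _ _), ← image_extendGlue τ₁, hb,
      condAvg_comp hρi, Set.preimage_image_eq _ hρi, condAvg_condAvg,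
      Set.inter_eq_left.2 (Subtype.coe_image_subset _ _)]
  have e₁ : ∀ S : Set V, ent q' (τ₁ '' S) = ent q S := fun S => ent_image hτ.inj₁ (h₁ S)
  have e₂ : ∀ S : Set L, ent q' (τ₂ '' S) = ent q (Subtype.val '' S) := fun S => by
    rw [← image_extendGlue τ₁]
    exact ent_image hρi (h₂ S)
  have hq'0 : ∀ x, 0 ≤ q' x := fun x =>
    div_nonneg (mul_nonneg (ha0 x) (hb0 x)) (condAvg_nonneg hq.nonneg _ _)
  refine ⟨hq'0, ?_, ?_, ?_, ?_⟩
  · rw [← expect_condAvg (Set.range τ₁), hA, ha, expect_comp_injective hτ.inj₁, hq.expect_eq_one]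
  · intro v w hvw x hx
    rcases frame_adj_starGlue hτ hvw hM.exists_pair (hM.sub_exists_pair L) with
      ⟨v, w, hadj, rfl, rfl⟩ | ⟨v, w, hadj, rfl, rfl⟩
    · refine hq.adj v w hadj (x ∘ τ₁) fun h => hx ?_
      simp only [hq'e, ha, h, zero_mul, zero_div]
    · have hbx : b x ≠ 0 := fun h => hx (by simp only [hq'e, h, mul_zero, zero_div])
      -- Some point in the support of `q` agrees with `x ∘ ρ` on `L`, where both endpoints lie.
      obtain ⟨y, -, hy⟩ := Finset.exists_ne_zero_of_expect_ne_zero hbx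
      have h := hq.adj v w (frame_adj_sub.1 hadj) _ hy
      rw [Set.piecewise_eq_of_mem _ _ _ v.2, Set.piecewise_eq_of_mem _ _ _ w.2] at h
      simpa only [Function.comp, hρ, extendGlue_coe] using h
  · intro v w hvw
    rcases frame_adj_starGlue hτ hvw hM.exists_pair (hM.sub_exists_pair L) with
      ⟨v, w, hadj, rfl, rfl⟩ | ⟨v, w, hadj, rfl, rfl⟩
    · rw [← Set.image_pair, e₁, hq.ent_pair v w hadj]
    · rw [← Set.image_pair, e₂, Set.image_pair, hq.ent_pair v w (frame_adj_sub.1 hadj)]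
  · have hglue : ∀ K₁ : Set V, ∀ K₂ : Set L, X ⊆ K₁ → Set.range (Set.inclusion hX) ⊆ K₂ →
        ent q' (τ₁ '' K₁ ∪ τ₂ '' K₂) + ent q' (τ₁ '' K₁ ∩ τ₂ '' K₂) =
          ent q' (τ₁ '' K₁) + ent q' (τ₂ '' K₂) := by
      intro K₁ K₂ hX₁ hX₂
      have hAB : Set.range τ₁ ∩ Set.range τ₂ = τ₁ '' X := by
        rw [← preimage_range_right hτ, Set.image_preimage_eq_range_inter]
      have hS : τ₁ '' X ⊆ τ₁ '' K₁ := Set.image_mono hX₁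
      have hT : τ₁ '' X ⊆ τ₂ '' K₂ := by
        rintro _ ⟨v, hv, rfl⟩
        exact ⟨⟨v, hX hv⟩, hX₂ ⟨⟨v, hv⟩, rfl⟩,
          ((hτ.apply_eq_apply_iff _ _).2 ⟨rfl, hv⟩).symm⟩
      -- As both sets contain the copy of `X`, they meet in exactly that copy, so the marginal on
      -- the intersection is `c`.
      have hST : τ₁ '' K₁ ∩ τ₂ '' K₂ = τ₁ '' X :=
        (hAB ▸ Set.inter_subset_inter (Set.image_subset_range _ _)
          (Set.image_subset_range _ _)).antisymm (Set.subset_inter hS hT)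
      refine ent_modular_of_mul_eq_mul hq'0 fun x => ?_
      rw [hST, h₁ X, hA' _ (Set.image_subset_range _ _), hB' _ (Set.image_subset_range _ _)]
      exact condAvg_union_condProduct ha0 hadep hbdep hca hcb (Set.image_subset_range _ _)
        (Set.image_subset_range _ _) (hAB ▸ hS) (hAB ▸ hT) x
    rintro A B (⟨A, B, h, rfl, rfl⟩ | ⟨A, B, h, rfl, rfl⟩ |
      ⟨K₁, -, K₂, -, s₁, s₂, ⟨rfl, rfl⟩ | ⟨rfl, rfl⟩⟩)
    · rw [← Set.image_union, ← Set.image_inter hτ.inj₁, e₁, e₁, e₁, e₁, hq.modular A B h]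
    · rw [← Set.image_union, ← Set.image_inter hτ.inj₂, e₂, e₂, e₂, e₂, Set.image_union,
        Set.image_inter Subtype.val_injective, hq.modular _ _ h]
    · exact hglue K₁ K₂ (by simpa using s₁) s₂
    · rw [Set.union_comm, Set.inter_comm, add_comm (ent q' (τ₂ '' K₂))]
      exact hglue K₁ K₂ (by simpa using s₁) s₂

end Reflect

theorem IsReflectionComplex.pairCovered_and_exists_isWitness [Fintype W] [Nonempty W]
    {G : SimpleGraph W} (hG : 0 < homDensity singleEdge G) {M : BHypergraph V}
    (hM : M.IsReflectionComplex) :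
    Finite V ∧ M.PairCovered ∧ ∀ [Fintype V], ∃ q, M.IsWitness G q := by
  induction hM with
  | triv hV =>
    exact ⟨Nat.finite_of_card_ne_zero (by omega), pairCovered_triv hV,
      exists_isWitness_triv hV G hG⟩
  | @reflect V V' M hM L X hL hX τ₁ τ₂ hτ ih =>
    obtain ⟨hfin, hcov, hex⟩ := ih
    refine ⟨?_, hcov.reflect hL hτ, ?_⟩
    · rw [← Set.finite_univ_iff, ← hτ.cover]
      exact (Set.finite_range τ₁).union (Set.finite_range τ₂)
    · intro _
      have := Fintype.ofFinite V
      obtain ⟨q, hq⟩ := hex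
      exact ⟨_, hq.reflect hcov hτ⟩

end BHypergraph

/-! ### Evaluating thickness at the entropy function -/

/-- The linear functional on set functions with value `F S` at `1_S`. -/
def setEval {V : Type u} [Fintype V] (F : Set V → ℝ) : (Set V → ℝ) →ₗ[ℝ] ℝ :=
  ∑ S : Set V, F S • LinearMap.proj S

theorem setEval_oneAt [Fintype V] (F : Set V → ℝ) (S : Set V) : setEval F (oneAt S) = F S := by
  simp [setEval, oneAt]

theorem setEval_tFun [Fintype V] (F : Set V → ℝ) (A B : Set V) :
    setEval F (tFun A B) = F (A ∪ B) - F A - F B + F (A ∩ B) := by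
  simp [tFun, setEval_oneAt]

theorem setEval_WSpace [Fintype V] {F : Set V → ℝ} {b : Set V → Set V → Prop}
    (hF : ∀ A B, b A B → F (A ∪ B) + F (A ∩ B) = F A + F B) {g : Set V → ℝ} (hg : g ∈ WSpace b) :
    setEval F g = 0 := by
  have h : WSpace b ≤ LinearMap.ker (setEval F) := by
    refine Submodule.span_le.2 ?_
    rintro _ ⟨A, B, hAB, rfl⟩
    rw [SetLike.mem_coe, LinearMap.mem_ker, setEval_tFun]
    linarith [hF A B hAB]
  exact h hg

theorem setEval_QCone_nonpos [Fintype V] {F : Set V → ℝ} (h0 : F ∅ = 0) (hF : ∀ S, F S ≤ 0)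
    (hsub : ∀ A B, F (A ∪ B) + F (A ∩ B) ≤ F A + F B) {g : Set V → ℝ} (hg : g ∈ QCone V) :
    setEval F g ≤ 0 := by
  obtain ⟨l, hl, k, hk, rfl⟩ := hg
  obtain ⟨r, rfl⟩ := Submodule.mem_span_singleton.1 hl
  have hk' : setEval F k ≤ 0 := by
    refine Submodule.span_induction (p := fun k _ => setEval F k ≤ 0) ?_ (by simp) ?_ ?_ hk
    · rintro _ (⟨A, B, rfl⟩ | ⟨A, rfl⟩)
      · rw [setEval_tFun]
        linarith [hsub A B]
      · rw [setEval_oneAt]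
        exact hF A
    · intro x y _ _ hx hy
      rw [map_add]
      linarith
    · intro r x _ hx
      rw [NNReal.smul_def, map_smul, smul_eq_mul]
      exact mul_nonpos_of_nonneg_of_nonpos r.2 hx
  simp only [map_add, map_smul, setEval_oneAt, h0, smul_zero, zero_add]
  exact hk'

theorem setEval_hFun_univ [Fintype V] (F : Set V → ℝ) (H : SimpleGraph V) :
    setEval F (hFun H Set.univ) = -F Set.univ + ∑ e ∈ H.edgeFinset, F (e : Set V) -
      ∑ v, (((H.neighborSet v).ncard : ℝ) - 1) * F {v} := by
  simp [hFun, setEval_oneAt]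

theorem homDensity_nonneg {V W : Type*} (H : SimpleGraph V) (G : SimpleGraph W) :
    0 ≤ homDensity H G :=
  div_nonneg (Nat.cast_nonneg _) (Nat.cast_nonneg _)

theorem homDensity_bot {V W : Type*} [Finite V] [Finite W] [Nonempty W] (G : SimpleGraph W) :
    homDensity (⊥ : SimpleGraph V) G = 1 := by
  have := Fintype.ofFinite V
  have := Fintype.ofFinite W
  simp [homDensity_eq_expect]

theorem BHypergraph.IsThick.log_homDensity_ge [Fintype V] [Fintype W] [Nonempty W]
    {G : SimpleGraph W} (hG : 0 < homDensity singleEdge G) {M : BHypergraph V}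
    (hM : M.IsReflectionComplex) (hthick : M.IsThick) :
    M.frame.edgeSet.ncard * Real.log (homDensity singleEdge G) ≤
      Real.log (homDensity M.frame G) := by
  obtain ⟨-, hcov, hex⟩ := hM.pairCovered_and_exists_isWitness hG
  obtain ⟨q, hq⟩ := hex
  obtain ⟨w, hw, k, hk, hwk⟩ := hthick
  have hnonpos := ent_nonpos hq.nonneg hq.expect_eq_one
  have h : setEval (ent q) (hFun M.frame Set.univ) ≤ 0 := by
    rw [← hwk, map_add, setEval_WSpace hq.modular hw, zero_add]
    exact setEval_QCone_nonpos (ent_empty hq.expect_eq_one) hnonpos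
      (ent_submodular hq.nonneg hq.expect_eq_one) hk
  rw [setEval_hFun_univ] at h
  have hE : ∑ e ∈ M.frame.edgeFinset, ent q (e : Set V) =
      M.frame.edgeSet.ncard * Real.log (homDensity singleEdge G) := by
    rw [Finset.sum_congr rfl (g := fun _ => Real.log (homDensity singleEdge G)),
      Finset.sum_const, nsmul_eq_mul, ← SimpleGraph.coe_edgeFinset, Set.ncard_coe_finset]
    intro e he
    induction e with
    | _ v w =>
      rw [SimpleGraph.mem_edgeFinset, SimpleGraph.mem_edgeSet] at he
      rw [Sym2.coe_mk, hq.ent_pair v w he]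
  -- Pair covering makes every degree at least 1, so the singleton terms have a sign and can be
  -- dropped.
  have hD : ∑ v, (((M.frame.neighborSet v).ncard : ℝ) - 1) * ent q {v} ≤ 0 := by
    refine Finset.sum_nonpos fun v _ => mul_nonpos_of_nonneg_of_nonpos ?_ (hnonpos _)
    obtain ⟨K, hK, hv⟩ := hcov.exists_edge v
    obtain ⟨w, -, hvw⟩ := hcov.exists_pair K hK v hv
    have : 0 < (M.frame.neighborSet v).ncard := (Set.ncard_pos).2 ⟨w, hvw⟩
    rw [sub_nonneg]
    exact_mod_cast this
  have hU : ent q Set.univ ≤ Real.log (homDensity M.frame G) := by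
    rw [homDensity_eq_expect]
    convert ent_univ_le_log hq.nonneg hq.expect_eq_one
      (P := fun x => ∀ a b, M.frame.Adj a b → G.Adj (x a) (x b))
      fun x hx a b hab => hq.adj a b hab x hx
  linarith

theorem BHypergraph.IsWitness.homDensity_frame_pos [Fintype V] [Fintype W] [Nonempty W]
    {G : SimpleGraph W} {M : BHypergraph V} {q : (V → W) → ℝ} (hq : M.IsWitness G q) :
    0 < homDensity M.frame G := by
  obtain ⟨x, hx⟩ : ∃ x, q x ≠ 0 := by
    by_contra! h
    simpa [h] using hq.expect_eq_one
  rw [homDensity_eq_expect]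
  exact Finset.expect_pos' (fun x _ => by split_ifs <;> norm_num)
    ⟨x, Finset.mem_univ _, by rw [if_pos fun a b hab => hq.adj a b hab x hx]; exact one_pos⟩

end Witness

end

theorem mainTheorem1 {V : Type*} [Fintype V] (H : SimpleGraph V) (hH : IsThickGraph H)
    {W : Type*} [Fintype W] [Nonempty W] (G : SimpleGraph W) :
    homDensity H G ≥ homDensity singleEdge G ^ H.edgeSet.ncard := by
  obtain ⟨M, hM, hthick, rfl⟩ := hH
  rcases (homDensity_nonneg singleEdge G).eq_or_lt with h0 | hpos
  -- If `t(e,G) = 0` there is no uniform random edge. The right side is then `0`, except that `0 ^ 0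
  -- = 1` for an edgeless graph, whose density is 1.
  · by_cases h : M.frame = ⊥
    · simp [h, homDensity_bot]
    · obtain ⟨a, b, hab⟩ := SimpleGraph.ne_bot_iff_exists_adj.1 h
      have hne : M.frame.edgeSet.ncard ≠ 0 :=
        Set.ncard_ne_zero_of_mem (a := s(a, b)) hab
      rw [← h0, zero_pow hne]
      exact homDensity_nonneg _ _
  · obtain ⟨-, -, hex⟩ := hM.pairCovered_and_exists_isWitness hpos
    obtain ⟨q, hq⟩ := hex
    rw [ge_iff_le, ← Real.log_le_log_iff (pow_pos hpos _) hq.homDensity_frame_pos, Real.log_pow]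
    exact hthick.log_homDensity_ge hpos hM
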